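/- Let $\mathcal X\subset\mathbb C$ be a constellation of $M=2^m$ points, used with equal probabilities, with zero mean and unit average energy, i.e. $\sum_{x\in\mathcal X}x=0$ and $\frac1M\sum_{x\in\mathcal X}|x|^2=1$. Let $\gamma:\{0,1\}^m\to\mathcal X$ be a binary labeling (a bijection), and for $1\le i\le m$ and $b\in\{0,1\}$ let $\mathcal X_b^i\subset\mathcal X$ be the set of symbols whose $i$-th label bit equals $b$. For a finite nonempty $S\subset\mathbb C$ put $\mu_1(S)=\frac1{|S|}\sum_{x\in S}x$, $\mu_2(S)=\frac1{|S|}\sum_{x\in S}|x|^2$ and $\mu_2'(S)=\frac1{|S|}\sum_{x\in S}x^2$. Consider the channel $Y=H\sqrt{\mathrm{SNR}}\,X+Z$, where $Z$ is circularly symmetric complex Gaussian noise of unit variance (density $\frac1\pi e^{-|z|^2}$) and the complex fading coefficient $H$ is independent of $X$ and $Z$ and known at the receiver. The BICM capacity (in nats per channel use) is $$C_{\mathcal X,\gamma}(\mathrm{SNR})=\sum_{i=1}^m\frac12\sum_{b=0,1}\mathbb E\left[\log\frac{\sum_{x'\in\mathcal X_b^i}e^{-|H\sqrt{\mathrm{SNR}}(X-x')+Z|^2}}{\frac12\sum_{x'\in\mathcal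 X}e^{-|H\sqrt{\mathrm{SNR}}(X-x')+Z|^2}}\right],$$ where, for each $i$ and $b$, the expectation is over $X$ uniform on $\mathcal X_b^i$, and over $Z$ and $H$. Set $$c_1=\sum_{i=1}^m\frac12\sum_{b=0,1}|\mu_1(\mathcal X_b^i)|^2,$$ $$c_2=\sum_{i=1}^m\frac14\sum_{b=0,1}\Bigl[\bigl(\mu_2(\mathcal X_b^i)-|\mu_1(\mathcal X_b^i)|^2\bigr)^2-\bigl(1+|\mu_2'(\mathcal X)|^2\bigr)+\bigl|\mu_2'(\mathcal X_b^i)-\mu_1(\mathcal X_b^i)^2\bigr|^2\Bigr].$$ Then on the channel without fading ($H=1$), as $\mathrm{SNR}\to0^+$, $$C_{\mathcal X,\gamma}(\mathrm{SNR})=c_1\,\mathrm{SNR}+c_2\,\mathrm{SNR}^2+o(\mathrm{SNR}^2).$$ More generally, for every distribution of $H$ with $\mathbb E[|H|^4]<\infty$, as $\mathrm{SNR}\to0^+$, $$C_{\mathcal X,\gamma}(\mathrm{SNR})=\mathbb E[|H|^2]\,c_1\,\mathrm{SNR}+\mathbb E[|H|^4]\,c_2\,\mathrm{SNR}^2+o(\mathrm{SNR}^2).$$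 -/

import Mathlib

open MeasureTheory Filter Topology Asymptotics

noncomputable section

namespace BICM

/-- The mean of the symbols of a finite set `S ⊆ ℂ` (used with equal probabilities). -/
def mu1 (S : Finset ℂ) : ℂ := (∑ x ∈ S, x) / (S.card : ℂ)

/-- The second moment (average energy) of the symbols of `S`. -/
def mu2 (S : Finset ℂ) : ℝ := (∑ x ∈ S, ‖x‖ ^ 2) / (S.card : ℝ)

/-- The second-order pseudo-moment of `S`: the average of the squared symbols. -/
def mu2' (S : Finset ℂ) : ℂ := (∑ x ∈ S, x ^ 2) / (S.card : ℂ)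

/-- The subset of the symbols whose binary label has the bit `b` in position `i`, for a
constellation `X` and a binary labeling `γ` (a bijection from the labels of `m` bits to `X`). -/
def bitSubset {m : ℕ} {X : Finset ℂ} (γ : (Fin m → Bool) ≃ X) (i : Fin m) (b : Bool) :
    Finset ℂ :=
  (Finset.univ.filter fun c : Fin m → Bool => c i = b).map
    (γ.toEmbedding.trans (Function.Embedding.subtype _))

/-- The density, with respect to Lebesgue measure on `ℂ`, of circularly symmetric complex
Gaussian noise of unit variance. -/
def noiseDensity (z : ℂ) : ℝ := Real.exp (-‖z‖ ^ 2) / Real.pi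

/-- The mutual information (in nats) `I(B_i; Y)` between the `i`-th label bit, which is uniform on
`{0, 1}`, and the output of the channel `Y = H √SNR X + Z`, where `H` has law `ν` and is known at
the receiver, `Z` is the noise, and `X` is uniform on the symbols whose `i`-th bit is `B_i`:
the expectation over `B_i`, `X`, `H` and `Z` of
`log ((∑_{x' ∈ X_b^i} exp (-|H √SNR (X - x') + Z|²)) /
  (½ ∑_{x' ∈ X} exp (-|H √SNR (X - x') + Z|²)))`. -/
def bitInformation (ν : Measure ℂ) {m : ℕ} {X : Finset ℂ} (γ : (Fin m → Bool) ≃ X) (snr : ℝ)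
    (i : Fin m) : ℝ :=
  (1 / 2) * ∑ b : Bool, (1 / ((bitSubset γ i b).card : ℝ)) * ∑ x ∈ bitSubset γ i b,
    ∫ h : ℂ, (∫ z : ℂ, noiseDensity z *
      Real.log
        ((∑ x' ∈ bitSubset γ i b, Real.exp (-‖h * (Real.sqrt snr : ℂ) * (x - x') + z‖ ^ 2)) /
          ((1 / 2) * ∑ x' ∈ X, Real.exp (-‖h * (Real.sqrt snr : ℂ) * (x - x') + z‖ ^ 2)))) ∂ν

/-- The BICM capacity, in nats per channel use, of the constellation `X` with the labeling `γ`
at the signal-to-noise ratio `snr`, for fading coefficients with law `ν`. -/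
def capacity (ν : Measure ℂ) {m : ℕ} {X : Finset ℂ} (γ : (Fin m → Bool) ≃ X) (snr : ℝ) : ℝ :=
  ∑ i : Fin m, bitInformation ν γ snr i

/-- The BICM capacity on the channel without fading (`H = 1`). -/
def awgnCapacity {m : ℕ} {X : Finset ℂ} (γ : (Fin m → Bool) ≃ X) (snr : ℝ) : ℝ :=
  capacity (Measure.dirac 1) γ snr

/-- `c₁` and `c₂` are the first two coefficients of the expansion of `C` at low `SNR`:
`C(SNR) = c₁ SNR + c₂ SNR² + o(SNR²)` as `SNR → 0`, `SNR > 0`. -/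
def HasLowSNRCoefficients (C : ℝ → ℝ) (c₁ c₂ : ℝ) : Prop :=
  (fun snr : ℝ => C snr - (c₁ * snr + c₂ * snr ^ 2)) =o[𝓝[>] 0] fun snr : ℝ => snr ^ 2

end BICM

end

noncomputable section

namespace BICM

-- Each bit contributes the difference between the information carried by all of `X` and the average
-- of the informations carried by its two halves, so it suffices to expand the information `I(S; a)`
-- of a uniform input on `S` with complex gain `a`. By the chain rule for relative entropy, `-I(S;
-- a)` is the divergence of the output from pure noise minus the average squared norm of the shifts
-- (`negInformation_eq`). Translating the symbols does not change the information, so `S` may be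
-- centred at its mean.
--
-- For centred `S` the output likelihood `L` relative to the noise satisfies `L - 1 = O(‖a‖²)`,
-- hence `∫ L log L` equals half the chi-square divergence up to `O(‖a‖⁶)`. The second moment of `L`
-- is exactly the average of `exp (2⟪v, v'⟫)` over pairs of shifted symbols, and the quadratic term
-- of this exponential produces the variance and the pseudo-variance.
--
-- With fading, `a = h √snr`. The local expansion and a crude global bound together give a remainder
-- at most `K ‖a‖⁴` everywhere, so dominated convergence needs only the fourth moment of `H`.

-- Taylor estimates for `exp` and `y log y`

theorem abs_exp_sub_sum_range_le (t : ℝ) (n : ℕ) :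
    |Real.exp t - ∑ k ∈ Finset.range n, t ^ k / k.factorial| ≤ |t| ^ n * Real.exp |t| := by
  have h := Complex.norm_exp_sub_sum_le_norm_mul_exp (t : ℂ) n
  rw [Complex.norm_real, Real.norm_eq_abs] at h
  rw [← Real.norm_eq_abs, ← Complex.norm_real]
  push_cast
  exact h

/-- The second-order Taylor expansion of `y log y` at `1`, with a remainder valid for all `y > 0`. -/
theorem abs_mul_log_sub_taylor_le {y : ℝ} (hy : 0 < y) :
    |y * Real.log y - (y - 1) - (y - 1) ^ 2 / 2| ≤ 4 * |y - 1| ^ 3 := by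
  have h1 : y * Real.log y ≤ y * (y - 1) :=
    mul_le_mul_of_nonneg_left (Real.log_le_sub_one_of_pos hy) hy.le
  have h2 : y - 1 ≤ y * Real.log y := by
    have := mul_le_mul_of_nonneg_left (Real.one_sub_inv_le_log_of_pos hy) hy.le
    rwa [mul_sub, mul_inv_cancel₀ hy.ne', mul_one] at this
  obtain ⟨u, rfl⟩ : ∃ u, y = 1 + u := ⟨y - 1, by ring⟩
  rw [add_sub_cancel_left] at *
  have hu0 := abs_nonneg u
  by_cases hu : |u| ≤ 1 / 2
  · have h3 := Real.abs_log_sub_add_sum_range_le (x := -u) (by rw [abs_neg]; linarith) 2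
    rw [abs_neg] at h3
    have h4 : |u| ^ (2 + 1) / (1 - |u|) ≤ 2 * |u| ^ 3 := by
      rw [div_le_iff₀ (by linarith)]
      have := mul_nonneg (pow_nonneg hu0 3) (sub_nonneg.2 hu)
      norm_num
      linarith
    have h5 : |Real.log (1 + u) - u + u ^ 2 / 2| ≤ 2 * |u| ^ 3 := by
      refine le_trans (le_of_eq ?_) (h3.trans h4)
      congr 1
      simp [Finset.sum_range_succ]
      ring
    have h6 : (1 + u) * Real.log (1 + u) - u - u ^ 2 / 2
        = (1 + u) * (Real.log (1 + u) - u + u ^ 2 / 2) - u ^ 3 / 2 := by ring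
    rw [h6]
    refine (abs_sub _ _).trans ?_
    rw [abs_mul, abs_div, abs_pow, abs_of_pos hy, abs_of_pos (two_pos : (0 : ℝ) < 2)]
    have h7 : 1 + u ≤ 3 / 2 := by linarith [le_abs_self u]
    nlinarith [mul_le_mul h7 h5 (abs_nonneg _) (by norm_num), pow_nonneg hu0 3]
  · push Not at hu
    -- Away from `1` the series is useless, but `h1` and `h2` give `0 ≤ y log y - u ≤ u²`, and `u² ≤
    -- 2|u|³` there.
    have h3 : |(1 + u) * Real.log (1 + u) - u - u ^ 2 / 2| ≤ u ^ 2 / 2 := by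
      rw [abs_le]
      constructor <;> nlinarith
    refine h3.trans ?_
    rw [← sq_abs u]
    nlinarith [sq_nonneg |u|, mul_le_mul_of_nonneg_right hu.le (sq_nonneg |u|)]

-- Gaussian integrals against the noise

theorem noiseDensity_nonneg (z : ℂ) : 0 ≤ noiseDensity z := by
  unfold noiseDensity; positivity

theorem continuous_noiseDensity : Continuous noiseDensity := by
  unfold noiseDensity; fun_prop

theorem noiseDensity_neg (z : ℂ) : noiseDensity (-z) = noiseDensity z := by
  simp [noiseDensity]

theorem noiseDensity_sub (w v : ℂ) :
    noiseDensity (w - v) = noiseDensity w * Real.exp (2 * inner ℝ v w - ‖v‖ ^ 2) := by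
  unfold noiseDensity
  rw [norm_sub_sq_real, div_mul_eq_mul_div, ← Real.exp_add, real_inner_comm]
  congr 2
  ring

/-- Puts the integrand in the form of the complex Gaussian integrals of `GaussianFourier`, with `b =
1` and `c = 2`. -/
theorem noiseDensity_mul_exp_inner_eq_re (v z : ℂ) :
    noiseDensity z * Real.exp (2 * inner ℝ v z)
      = (Complex.exp (-1 * ‖z‖ ^ 2 + 2 * inner ℝ v z)).re / Real.pi := by
  rw [show (-1 * (‖z‖ : ℂ) ^ 2 + 2 * (inner ℝ v z : ℝ))
    = ((-‖z‖ ^ 2 + 2 * inner ℝ v z : ℝ) : ℂ) by push_cast; ring, Complex.exp_ofReal_re,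
    Real.exp_add, noiseDensity]
  ring

theorem integrable_noiseDensity_mul_exp_inner (v : ℂ) :
    Integrable fun z : ℂ => noiseDensity z * Real.exp (2 * inner ℝ v z) := by
  simp_rw [noiseDensity_mul_exp_inner_eq_re]
  exact (GaussianFourier.integrable_cexp_neg_mul_sq_norm_add (V := ℂ) (b := 1)
    (by simp) 2 v).re.div_const _

theorem integral_noiseDensity_mul_exp_inner (v : ℂ) :
    ∫ z : ℂ, noiseDensity z * Real.exp (2 * inner ℝ v z) = Real.exp (‖v‖ ^ 2) := by
  simp_rw [noiseDensity_mul_exp_inner_eq_re]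
  have h := GaussianFourier.integral_cexp_neg_mul_sq_norm_add (V := ℂ) (b := 1) (by simp) 2 v
  have h' := integral_re (GaussianFourier.integrable_cexp_neg_mul_sq_norm_add (V := ℂ) (b := 1)
    (by simp) 2 v)
  rw [h] at h'
  simp only [RCLike.re_eq_complex_re] at h'
  rw [integral_div, h', Complex.finrank_real_complex]
  have e : ((Real.pi : ℂ) / 1) ^ (((2 : ℕ) : ℂ) / 2) * Complex.exp (2 ^ 2 * ‖v‖ ^ 2 / (4 * 1))
      = ((Real.pi * Real.exp (‖v‖ ^ 2) : ℝ) : ℂ) := by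
    push_cast
    rw [div_one, div_self two_ne_zero, Complex.cpow_one]
    congr 2
    ring
  rw [e, Complex.ofReal_re, mul_div_cancel_left₀ _ Real.pi_ne_zero]

/-- Since `c‖z‖ ≤ ‖z‖²/2 + c²/2`, half of the Gaussian decay absorbs the exponential. -/
theorem integrable_noiseDensity_mul_exp_norm (c : ℝ) :
    Integrable fun z : ℂ => noiseDensity z * Real.exp (c * ‖z‖) := by
  have h := (GaussianFourier.integrable_cexp_neg_mul_sq_norm_add (V := ℂ) (b := 1 / 2)
    (by norm_num) 0 0).re.const_mul (Real.exp (c ^ 2 / 2) / Real.pi)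
  refine h.mono' (by
    have := continuous_noiseDensity
    exact (by fun_prop : Continuous fun z : ℂ => noiseDensity z * Real.exp (c * ‖z‖))
      |>.aestronglyMeasurable) (.of_forall fun z => ?_)
  have e : (-(1 / 2) * (‖z‖ : ℂ) ^ 2 + 0 * (inner ℝ (0 : ℂ) z : ℝ))
      = ((-‖z‖ ^ 2 / 2 : ℝ) : ℂ) := by push_cast; ring
  simp only [RCLike.re_eq_complex_re]
  rw [e, Complex.exp_ofReal_re, Real.norm_eq_abs,
    abs_of_nonneg (mul_nonneg (noiseDensity_nonneg z) (Real.exp_pos _).le), noiseDensity,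
    div_mul_eq_mul_div, div_mul_eq_mul_div, ← Real.exp_add, ← Real.exp_add]
  refine div_le_div_of_nonneg_right (Real.exp_le_exp.2 ?_) Real.pi_pos.le
  nlinarith [sq_nonneg (c - ‖z‖)]

theorem integrable_noiseDensity : Integrable noiseDensity := by
  simpa using integrable_noiseDensity_mul_exp_norm 0

theorem integral_noiseDensity : ∫ z : ℂ, noiseDensity z = 1 := by
  simpa using integral_noiseDensity_mul_exp_inner 0

/-- A continuous function of at most exponential growth is integrable against the noise. -/
theorem integrable_noiseDensity_mul_of_le {f : ℂ → ℝ} (hf : Continuous f) {A c : ℝ}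
    (h : ∀ z, |f z| ≤ A * Real.exp (c * ‖z‖)) : Integrable fun z => noiseDensity z * f z := by
  refine ((integrable_noiseDensity_mul_exp_norm c).const_mul A).mono'
    (continuous_noiseDensity.mul hf).aestronglyMeasurable (.of_forall fun z => ?_)
  rw [Real.norm_eq_abs, abs_mul, abs_of_nonneg (noiseDensity_nonneg z), mul_left_comm]
  exact mul_le_mul_of_nonneg_left (h z) (noiseDensity_nonneg z)

theorem integrable_noiseDensity_mul_of_abs_le {f : ℂ → ℝ} (hf : Continuous f) {A B : ℝ}
    (hA : 0 ≤ A) (hB : 0 ≤ B) (h : ∀ z, |f z| ≤ A * ‖z‖ + B) :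
    Integrable fun z => noiseDensity z * f z := by
  refine integrable_noiseDensity_mul_of_le hf (A := A + B) (c := 1) fun z => (h z).trans ?_
  have h1 := Real.add_one_le_exp ‖z‖
  have h2 := norm_nonneg z
  rw [one_mul, add_mul]
  have h3 : B * 1 ≤ B * Real.exp ‖z‖ := by gcongr; linarith
  have h4 : A * ‖z‖ ≤ A * Real.exp ‖z‖ := by gcongr; linarith
  linarith

theorem integrable_noiseDensity_mul_norm : Integrable fun z : ℂ => noiseDensity z * ‖z‖ :=
  integrable_noiseDensity_mul_of_abs_le continuous_norm zero_le_one le_rfl fun z => by simp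

theorem integrable_noiseDensity_mul_inner (v : ℂ) :
    Integrable fun z : ℂ => noiseDensity z * inner ℝ v z :=
  integrable_noiseDensity_mul_of_abs_le (by fun_prop) (norm_nonneg v) le_rfl fun z => by
    simpa using abs_real_inner_le_norm v z

theorem integral_noiseDensity_mul_inner (v : ℂ) :
    ∫ z : ℂ, noiseDensity z * inner ℝ v z = 0 := by
  have h := integral_neg_eq_self (fun z : ℂ => noiseDensity z * inner ℝ v z) volume
  simp only [noiseDensity_neg, inner_neg_right, mul_neg, integral_neg] at h
  linarith

-- Likelihoods and the chain rule for relative entropy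

/-- The log-likelihood ratio at `w` of a unit Gaussian centred at `v` against the one centred
at `0`. -/
def tilt (v w : ℂ) : ℝ := 2 * inner ℝ v w - ‖v‖ ^ 2

/-- The density at `w`, relative to the noise, of the noise shifted by a uniform point of the
family `v` on `S`. -/
def likelihood (S : Finset ℂ) (v : ℂ → ℂ) (w : ℂ) : ℝ :=
  (∑ x ∈ S, Real.exp (tilt (v x) w)) / (S.card : ℝ)

/-- The logarithm of the output likelihood averaged over `S`, relative to the noise, when `x` is
sent with gain `a` and the noise is `z`. -/
def logRatio (S : Finset ℂ) (a x z : ℂ) : ℝ :=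
  Real.log ((∑ x' ∈ S, Real.exp (‖z‖ ^ 2 - ‖a * (x - x') + z‖ ^ 2)) / (S.card : ℝ))

/-- The average of `logRatio S a x` over the noise. -/
def meanLogRatio (S : Finset ℂ) (a x : ℂ) : ℝ := ∫ z : ℂ, noiseDensity z * logRatio S a x z

/-- The average of `logRatio` over the noise and the symbols of `S`. It is the negative of the
mutual information of the channel with gain `a` and uniform input on `S`. -/
def negInformation (S : Finset ℂ) (a : ℂ) : ℝ :=
  (∑ x ∈ S, meanLogRatio S a x) / (S.card : ℝ)

theorem continuous_tilt (v : ℂ) : Continuous (tilt v) := by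
  unfold tilt; fun_prop

theorem abs_tilt_le (v w : ℂ) : |tilt v w| ≤ 2 * ‖v‖ * ‖w‖ + ‖v‖ ^ 2 := by
  have h := abs_le.1 (abs_real_inner_le_norm v w)
  rw [tilt, abs_le]
  constructor <;> nlinarith [sq_nonneg ‖v‖]

theorem abs_norm_sq_sub_le (d z : ℂ) :
    |‖z‖ ^ 2 - ‖d + z‖ ^ 2| ≤ ‖d‖ * (2 * ‖z‖ + ‖d‖) := by
  rw [norm_add_sq_real]
  have h := abs_le.1 (abs_real_inner_le_norm d z)
  rw [abs_le]
  constructor <;> nlinarith [sq_nonneg ‖d‖]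

theorem noiseDensity_sub_eq_mul_tilt (w v : ℂ) :
    noiseDensity (w - v) = noiseDensity w * Real.exp (tilt v w) := noiseDensity_sub w v

theorem exp_tilt_mul_exp_tilt (u v w : ℂ) :
    Real.exp (tilt u w) * Real.exp (tilt v w)
      = Real.exp (2 * inner ℝ (u + v) w) * Real.exp (-(‖u‖ ^ 2 + ‖v‖ ^ 2)) := by
  rw [← Real.exp_add, ← Real.exp_add, tilt, tilt, inner_add_left]
  congr 1
  ring

theorem integrable_noiseDensity_mul_exp_tilt_mul (u v : ℂ) :
    Integrable fun w => noiseDensity w * (Real.exp (tilt u w) * Real.exp (tilt v w)) := by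
  simp_rw [exp_tilt_mul_exp_tilt, ← mul_assoc]
  exact (integrable_noiseDensity_mul_exp_inner (u + v)).mul_const _

theorem integral_noiseDensity_mul_exp_tilt_mul (u v : ℂ) :
    ∫ w, noiseDensity w * (Real.exp (tilt u w) * Real.exp (tilt v w))
      = Real.exp (2 * inner ℝ u v) := by
  simp_rw [exp_tilt_mul_exp_tilt, ← mul_assoc]
  rw [integral_mul_const, integral_noiseDensity_mul_exp_inner, ← Real.exp_add, norm_add_sq_real]
  congr 1
  ring

/-- An average of exponentials lies between `exp (-B)` and `exp B`; no lower bound on individual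
weights is needed. -/
theorem abs_log_average_exp_le {ι : Type*} {S : Finset ι} (hS : S.Nonempty) {s : ι → ℝ} {B : ℝ}
    (h : ∀ x ∈ S, |s x| ≤ B) :
    |Real.log ((∑ x ∈ S, Real.exp (s x)) / (S.card : ℝ))| ≤ B := by
  have hn : (0 : ℝ) < S.card := by exact_mod_cast hS.card_pos
  have hpos : 0 < (∑ x ∈ S, Real.exp (s x)) / (S.card : ℝ) :=
    div_pos (Finset.sum_pos (fun x _ => Real.exp_pos _) hS) hn
  rw [abs_le, Real.le_log_iff_exp_le hpos, Real.log_le_iff_le_exp hpos, le_div_iff₀ hn,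
    div_le_iff₀ hn, mul_comm, mul_comm (Real.exp B), ← nsmul_eq_mul, ← nsmul_eq_mul]
  exact ⟨Finset.card_nsmul_le_sum _ _ _ fun x hx => Real.exp_le_exp.2 (abs_le.1 (h x hx)).1,
    Finset.sum_le_card_nsmul _ _ _ fun x hx => Real.exp_le_exp.2 (abs_le.1 (h x hx)).2⟩

theorem sum_exp_div_card_pos {ι : Type*} {S : Finset ι} (hS : S.Nonempty) (s : ι → ℝ) :
    0 < (∑ x ∈ S, Real.exp (s x)) / (S.card : ℝ) :=
  div_pos (Finset.sum_pos (fun x _ => Real.exp_pos _) hS) (by exact_mod_cast hS.card_pos)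

theorem likelihood_pos {S : Finset ℂ} (hS : S.Nonempty) (v : ℂ → ℂ) (w : ℂ) :
    0 < likelihood S v w := sum_exp_div_card_pos hS _

theorem continuous_likelihood (S : Finset ℂ) (v : ℂ → ℂ) : Continuous (likelihood S v) := by
  have := fun x => continuous_tilt (v x)
  unfold likelihood; fun_prop

theorem continuous_logRatio {S : Finset ℂ} (hS : S.Nonempty) (x : ℂ) :
    Continuous fun p : ℂ × ℂ => logRatio S p.1 x p.2 := by
  refine Continuous.log (by fun_prop) fun p => (sum_exp_div_card_pos hS _).ne'

theorem abs_logRatio_le {S : Finset ℂ} (hS : S.Nonempty) (a x z : ℂ) :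
    |logRatio S a x z| ≤ 2 * (‖a‖ * ∑ x' ∈ S, ‖x - x'‖) * ‖z‖
      + (‖a‖ * ∑ x' ∈ S, ‖x - x'‖) ^ 2 := by
  refine abs_log_average_exp_le hS fun x' hx' => (abs_norm_sq_sub_le _ _).trans ?_
  have h : ‖a * (x - x')‖ ≤ ‖a‖ * ∑ x' ∈ S, ‖x - x'‖ := by
    rw [norm_mul]
    exact mul_le_mul_of_nonneg_left
      (Finset.single_le_sum (f := fun x' => ‖x - x'‖) (fun _ _ => norm_nonneg _) hx')
      (norm_nonneg a)
  calc ‖a * (x - x')‖ * (2 * ‖z‖ + ‖a * (x - x')‖)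
      ≤ (‖a‖ * ∑ x' ∈ S, ‖x - x'‖) * (2 * ‖z‖ + ‖a‖ * ∑ x' ∈ S, ‖x - x'‖) := by gcongr
    _ = _ := by ring

theorem integrable_noiseDensity_mul_logRatio {S : Finset ℂ} (hS : S.Nonempty) (a x : ℂ) :
    Integrable fun z => noiseDensity z * logRatio S a x z := by
  have hf : Continuous fun z => logRatio S a x z :=
    Continuous.comp (g := fun p : ℂ × ℂ => logRatio S p.1 x p.2) (f := fun z => (a, z))
      (continuous_logRatio hS x) (by fun_prop)
  have hb := abs_logRatio_le hS a x
  have hD : 0 ≤ ‖a‖ * ∑ x' ∈ S, ‖x - x'‖ := by positivity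
  generalize ‖a‖ * ∑ x' ∈ S, ‖x - x'‖ = D at hb hD
  exact integrable_noiseDensity_mul_of_abs_le hf (mul_nonneg zero_le_two hD) (sq_nonneg D) hb

theorem stronglyMeasurable_meanLogRatio {S : Finset ℂ} (hS : S.Nonempty) (x : ℂ) :
    StronglyMeasurable fun a => meanLogRatio S a x := by
  have h := continuous_logRatio hS x
  have h' := continuous_noiseDensity
  exact StronglyMeasurable.integral_prod_right'
    (f := fun p : ℂ × ℂ => noiseDensity p.2 * logRatio S p.1 x p.2)
    (by fun_prop : Continuous _).stronglyMeasurable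

/-- Crude but valid for every gain: it gives integrability over the fading and controls `‖a‖ > 1`,
where the Taylor expansion says nothing. -/
theorem exists_abs_meanLogRatio_le {S : Finset ℂ} (hS : S.Nonempty) (x : ℂ) :
    ∃ C, 0 ≤ C ∧ ∀ a, |meanLogRatio S a x| ≤ C * (‖a‖ + ‖a‖ ^ 2) := by
  set D := ∑ x' ∈ S, ‖x - x'‖
  have hD : 0 ≤ D := by positivity
  have hM : 0 ≤ ∫ z : ℂ, noiseDensity z * ‖z‖ :=
    integral_nonneg fun z => mul_nonneg (noiseDensity_nonneg z) (norm_nonneg z)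
  refine ⟨2 * D * (∫ z : ℂ, noiseDensity z * ‖z‖) + D ^ 2, by positivity, fun a => ?_⟩
  have hi := (integrable_noiseDensity_mul_norm.const_mul (2 * (‖a‖ * D))).add
    (integrable_noiseDensity.const_mul ((‖a‖ * D) ^ 2))
  have h1 : |meanLogRatio S a x| ≤ ∫ z : ℂ, (2 * (‖a‖ * D) * (noiseDensity z * ‖z‖)
      + (‖a‖ * D) ^ 2 * noiseDensity z) := by
    rw [← Real.norm_eq_abs, meanLogRatio]
    refine norm_integral_le_of_norm_le hi (.of_forall fun z => ?_)
    rw [Real.norm_eq_abs, abs_mul, abs_of_nonneg (noiseDensity_nonneg z)]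
    refine (mul_le_mul_of_nonneg_left (abs_logRatio_le hS a x z) (noiseDensity_nonneg z)).trans
      (le_of_eq ?_)
    ring
  rw [integral_add (integrable_noiseDensity_mul_norm.const_mul _)
    (integrable_noiseDensity.const_mul _), integral_const_mul, integral_const_mul,
    integral_noiseDensity] at h1
  refine h1.trans ?_
  have h2 : 0 ≤ D * (∫ z : ℂ, noiseDensity z * ‖z‖) * ‖a‖ ^ 2 := by positivity
  have h3 : 0 ≤ D ^ 2 * ‖a‖ := by positivity
  nlinarith

/-- The log-likelihood ratios only depend on the differences of the symbols, so that the symbols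
can be translated by any `c`. -/
theorem logRatio_eq {S : Finset ℂ} (hS : S.Nonempty) (a c x z : ℂ) :
    logRatio S a x z = Real.log (likelihood S (fun x => a * (x - c)) (z + a * (x - c)))
      - tilt (a * (x - c)) (z + a * (x - c)) := by
  rw [← Real.log_exp (tilt (a * (x - c)) (z + a * (x - c))),
    ← Real.log_div (likelihood_pos hS _ _).ne' (Real.exp_pos _).ne', logRatio, likelihood,
    div_right_comm, Finset.sum_div _ _ (Real.exp _)]
  congr 2
  refine Finset.sum_congr rfl fun x' _ => ?_
  rw [← Real.exp_sub]
  congr 1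
  have e : a * (x - x') + z = (z + a * (x - c)) - a * (x' - c) := by ring
  have e' : ‖z‖ ^ 2 = ‖(z + a * (x - c)) - a * (x - c)‖ ^ 2 := by rw [add_sub_cancel_right]
  rw [e', e, norm_sub_sq_real, norm_sub_sq_real, tilt, tilt,
    real_inner_comm (a * (x - c)), real_inner_comm (a * (x' - c))]
  ring

theorem tilt_add_self (v z : ℂ) : tilt v (z + v) = 2 * inner ℝ v z + ‖v‖ ^ 2 := by
  rw [tilt, inner_add_right, real_inner_self_eq_norm_sq]
  ring

theorem integrable_noiseDensity_mul_tilt_add_self (v : ℂ) :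
    Integrable fun z => noiseDensity z * tilt v (z + v) := by
  have h := ((integrable_noiseDensity_mul_inner v).const_mul 2).add
    (integrable_noiseDensity.mul_const (‖v‖ ^ 2))
  refine h.congr (.of_forall fun z => ?_)
  simp only [Pi.add_apply, tilt_add_self]
  ring

theorem integral_noiseDensity_mul_tilt_add_self (v : ℂ) :
    ∫ z, noiseDensity z * tilt v (z + v) = ‖v‖ ^ 2 := by
  have e : ∀ z, noiseDensity z * tilt v (z + v)
      = 2 * (noiseDensity z * inner ℝ v z) + noiseDensity z * ‖v‖ ^ 2 := fun z => by
    rw [tilt_add_self]; ring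
  simp_rw [e]
  rw [integral_add ((integrable_noiseDensity_mul_inner v).const_mul 2)
    (integrable_noiseDensity.mul_const (‖v‖ ^ 2)), integral_const_mul, integral_mul_const,
    integral_noiseDensity_mul_inner, integral_noiseDensity]
  ring

theorem integrable_noiseDensity_mul_log_likelihood_add {S : Finset ℂ} (hS : S.Nonempty)
    (a c x : ℂ) : Integrable fun z => noiseDensity z *
      Real.log (likelihood S (fun x => a * (x - c)) (z + a * (x - c))) := by
  refine ((integrable_noiseDensity_mul_logRatio hS a x).add
    (integrable_noiseDensity_mul_tilt_add_self (a * (x - c)))).congr (.of_forall fun z => ?_)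
  simp only [Pi.add_apply, logRatio_eq hS a c]
  ring

theorem integrable_noiseDensity_mul_exp_tilt_mul_log_likelihood {S : Finset ℂ}
    (hS : S.Nonempty) (a c x : ℂ) : Integrable fun w => noiseDensity w *
      Real.exp (tilt (a * (x - c)) w) * Real.log (likelihood S (fun x => a * (x - c)) w) := by
  refine ((integrable_noiseDensity_mul_log_likelihood_add hS a c x).comp_sub_right
    (a * (x - c))).congr (.of_forall fun w => ?_)
  simp only [sub_add_cancel, noiseDensity_sub_eq_mul_tilt]

/-- The substitution `w = z + a (x - c)` refers every symbol to the same noise measure, the shift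
becoming the weight `exp (tilt _ w)`. -/
theorem meanLogRatio_eq {S : Finset ℂ} (hS : S.Nonempty) (a c x : ℂ) :
    meanLogRatio S a x = (∫ w, noiseDensity w * Real.exp (tilt (a * (x - c)) w) *
      Real.log (likelihood S (fun x => a * (x - c)) w)) - ‖a * (x - c)‖ ^ 2 := by
  rw [meanLogRatio]
  simp_rw [logRatio_eq hS a c, mul_sub (noiseDensity _)]
  rw [integral_sub (integrable_noiseDensity_mul_log_likelihood_add hS a c x)
    (integrable_noiseDensity_mul_tilt_add_self _), integral_noiseDensity_mul_tilt_add_self,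
    ← integral_sub_right_eq_self _ (a * (x - c))]
  simp only [sub_add_cancel, noiseDensity_sub_eq_mul_tilt]

/-- Averaging the weights `exp (tilt _ w)` over `S` reproduces the likelihood, whence `L log L`. The
centre `c` is free because the left side depends only on differences of symbols. -/
theorem negInformation_eq {S : Finset ℂ} (hS : S.Nonempty) (a c : ℂ) :
    negInformation S a = (∫ w, noiseDensity w * (likelihood S (fun x => a * (x - c)) w *
      Real.log (likelihood S (fun x => a * (x - c)) w)))
      - ‖a‖ ^ 2 * ((∑ x ∈ S, ‖x - c‖ ^ 2) / (S.card : ℝ)) := by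
  rw [negInformation]
  simp_rw [meanLogRatio_eq hS a c]
  rw [Finset.sum_sub_distrib, sub_div, ← integral_finsetSum _ fun x _ =>
    integrable_noiseDensity_mul_exp_tilt_mul_log_likelihood hS a c x, ← integral_div]
  congr 1
  · congr 1 with w
    rw [← Finset.sum_mul, ← Finset.mul_sum, likelihood]
    ring
  · simp_rw [norm_mul, mul_pow, ← Finset.mul_sum]
    ring

-- Fourth-order expansion of the divergence from the noise

/-- Centring cancels the term linear in `a`, so the deviation is of order `‖a‖²` and its cube is
negligible at order `‖a‖⁴`. -/
theorem abs_likelihood_sub_one_le {S : Finset ℂ} (hS : S.Nonempty) {y : ℂ → ℂ}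
    (hy : ∑ x ∈ S, y x = 0) {D : ℝ} (hD : ∀ x ∈ S, ‖y x‖ ≤ D) {a : ℂ} (ha : ‖a‖ ≤ 1) (w : ℂ) :
    |likelihood S (fun x => a * y x) w - 1|
      ≤ ‖a‖ ^ 2 * (3 * Real.exp (2 * (2 * D * ‖w‖ + D ^ 2))) := by
  have hn : (0 : ℝ) < S.card := by exact_mod_cast hS.card_pos
  obtain ⟨x₀, hx₀⟩ := hS
  have hD0 : 0 ≤ D := (norm_nonneg _).trans (hD x₀ hx₀)
  have ha0 := norm_nonneg a
  set E := 2 * D * ‖w‖ + D ^ 2 with hE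
  have hE0 : 0 ≤ E := by positivity
  have hDE : D ^ 2 ≤ E := by
    rw [hE]; linarith [show 0 ≤ 2 * D * ‖w‖ by positivity]
  have key : ∀ x ∈ S, |Real.exp (tilt (a * y x) w) - 1 - 2 * inner ℝ (a * y x) w|
      ≤ ‖a‖ ^ 2 * (3 * Real.exp (2 * E)) := by
    intro x hx
    have hv : ‖a * y x‖ ≤ ‖a‖ * D := by
      rw [norm_mul]; exact mul_le_mul_of_nonneg_left (hD x hx) ha0
    have hv2 : ‖a * y x‖ ^ 2 ≤ ‖a‖ ^ 2 * D ^ 2 := by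
      rw [← mul_pow]; exact pow_le_pow_left₀ (norm_nonneg _) hv 2
    have ht : |tilt (a * y x) w| ≤ ‖a‖ * E := by
      refine (abs_tilt_le _ _).trans ?_
      have h1 : ‖a * y x‖ * ‖w‖ ≤ ‖a‖ * D * ‖w‖ :=
        mul_le_mul_of_nonneg_right hv (norm_nonneg w)
      have h2 : ‖a‖ ^ 2 * D ^ 2 ≤ ‖a‖ * D ^ 2 :=
        mul_le_mul_of_nonneg_right (by nlinarith) (sq_nonneg D)
      rw [hE]
      linarith
    have ht' : |tilt (a * y x) w| ≤ E := ht.trans (by nlinarith)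
    have h3 := abs_exp_sub_sum_range_le (tilt (a * y x) w) 2
    have h4 : |tilt (a * y x) w| ^ 2 * Real.exp |tilt (a * y x) w|
        ≤ (‖a‖ * E) ^ 2 * Real.exp E := by gcongr
    -- Polynomial factors are traded for exponentials: the `3` is `2` from here plus `1` for the
    -- term `‖a * y x‖ ^ 2` of the tilt.
    have h5 : E ^ 2 ≤ 2 * Real.exp E := by
      linarith [Real.quadratic_le_exp_of_nonneg hE0]
    have h6 : E ≤ Real.exp (2 * E) := by linarith [Real.add_one_le_exp (2 * E)]
    have h7 : (‖a‖ * E) ^ 2 * Real.exp E ≤ ‖a‖ ^ 2 * (2 * Real.exp (2 * E)) := by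
      rw [mul_pow, mul_assoc, two_mul E, Real.exp_add E E, ← mul_assoc 2]
      gcongr
    have e : Real.exp (tilt (a * y x) w) - 1 - 2 * inner ℝ (a * y x) w
        = (Real.exp (tilt (a * y x) w) - ∑ k ∈ Finset.range 2,
          tilt (a * y x) w ^ k / k.factorial) + -‖a * y x‖ ^ 2 := by
      rw [Finset.sum_range_succ, Finset.sum_range_one]
      simp [tilt]
      ring
    rw [e]
    refine (abs_add_le _ _).trans ?_
    rw [abs_neg, abs_of_nonneg (sq_nonneg ‖a * y x‖)]
    have h8 : ‖a‖ ^ 2 * D ^ 2 ≤ ‖a‖ ^ 2 * Real.exp (2 * E) := by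
      gcongr; exact hDE.trans h6
    linarith
  have hsum : likelihood S (fun x => a * y x) w - 1
      = (∑ x ∈ S, (Real.exp (tilt (a * y x) w) - 1 - 2 * inner ℝ (a * y x) w)) / S.card := by
    rw [Finset.sum_sub_distrib, Finset.sum_sub_distrib, ← Finset.mul_sum, ← sum_inner,
      ← Finset.mul_sum, hy, likelihood]
    simp only [mul_zero, inner_zero_left, sub_zero, Finset.sum_const, nsmul_eq_mul, mul_one]
    rw [sub_div, div_self hn.ne']
  rw [hsum, abs_div, abs_of_pos hn, div_le_iff₀ hn, mul_comm _ (S.card : ℝ), ← nsmul_eq_mul]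
  exact (Finset.abs_sum_le_sum_abs _ _).trans (Finset.sum_le_card_nsmul _ _ _ key)

theorem likelihood_sq (S : Finset ℂ) (v : ℂ → ℂ) (w : ℂ) :
    likelihood S v w ^ 2 = (∑ x ∈ S, ∑ x' ∈ S,
      Real.exp (tilt (v x) w) * Real.exp (tilt (v x') w)) / (S.card : ℝ) ^ 2 := by
  rw [likelihood, div_pow, sq (∑ x ∈ S, _), Finset.sum_mul_sum]

theorem noiseDensity_mul_likelihood_sq (S : Finset ℂ) (v : ℂ → ℂ) (w : ℂ) :
    noiseDensity w * likelihood S v w ^ 2 = (∑ x ∈ S, ∑ x' ∈ S,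
      noiseDensity w * (Real.exp (tilt (v x) w) * Real.exp (tilt (v x') w)))
        / (S.card : ℝ) ^ 2 := by
  rw [likelihood_sq, mul_div_assoc', Finset.mul_sum]
  simp_rw [Finset.mul_sum]

theorem integrable_noiseDensity_mul_likelihood_sq (S : Finset ℂ) (v : ℂ → ℂ) :
    Integrable fun w => noiseDensity w * likelihood S v w ^ 2 := by
  simp_rw [noiseDensity_mul_likelihood_sq]
  exact (integrable_finsetSum _ fun x _ => integrable_finsetSum _ fun x' _ =>
    integrable_noiseDensity_mul_exp_tilt_mul (v x) (v x')).div_const _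

/-- The square of an average is an average over pairs, and each pair is an explicit Gaussian
integral. -/
theorem integral_noiseDensity_mul_likelihood_sq (S : Finset ℂ) (v : ℂ → ℂ) :
    ∫ w, noiseDensity w * likelihood S v w ^ 2
      = (∑ x ∈ S, ∑ x' ∈ S, Real.exp (2 * inner ℝ (v x) (v x'))) / (S.card : ℝ) ^ 2 := by
  simp_rw [noiseDensity_mul_likelihood_sq]
  rw [integral_div, integral_finsetSum _ fun x _ => integrable_finsetSum _ fun x' _ =>
    integrable_noiseDensity_mul_exp_tilt_mul (v x) (v x')]
  congr 1
  refine Finset.sum_congr rfl fun x _ => ?_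
  rw [integral_finsetSum _ fun x' _ => integrable_noiseDensity_mul_exp_tilt_mul (v x) (v x')]
  simp_rw [integral_noiseDensity_mul_exp_tilt_mul]

/-- This is `(Re s)² = (|s|² + Re s²) / 2` for the Hermitian product `s`; the second term is the
source of the pseudo-moments. -/
theorem inner_mul_mul_sq (a u v : ℂ) :
    (inner ℝ (a * u) (a * v) : ℝ) ^ 2
      = ‖a‖ ^ 4 / 2 * (‖u‖ ^ 2 * ‖v‖ ^ 2 + inner ℝ (u ^ 2) (v ^ 2)) := by
  rw [show ‖a‖ ^ 4 = (‖a‖ ^ 2) ^ 2 by ring, Complex.sq_norm, Complex.sq_norm, Complex.sq_norm]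
  simp only [Complex.inner, Complex.normSq_apply, sq, Complex.mul_re,
    Complex.mul_im, Complex.conj_re, Complex.conj_im]
  ring

theorem sum_sum_inner_mul_mul_sq (S : Finset ℂ) (y : ℂ → ℂ) (a : ℂ) :
    ∑ x ∈ S, ∑ x' ∈ S, (inner ℝ (a * y x) (a * y x') : ℝ) ^ 2
      = ‖a‖ ^ 4 / 2 * ((∑ x ∈ S, ‖y x‖ ^ 2) ^ 2 + ‖∑ x ∈ S, y x ^ 2‖ ^ 2) := by
  simp_rw [inner_mul_mul_sq, ← Finset.mul_sum, Finset.sum_add_distrib]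
  rw [← real_inner_self_eq_norm_sq, sum_inner, sq (∑ x ∈ S, ‖y x‖ ^ 2), Finset.sum_mul_sum]
  simp_rw [inner_sum]

theorem sum_sum_inner_mul_mul {S : Finset ℂ} {y : ℂ → ℂ} (hy : ∑ x ∈ S, y x = 0) (a : ℂ) :
    ∑ x ∈ S, ∑ x' ∈ S, (inner ℝ (a * y x) (a * y x') : ℝ) = 0 := by
  simp_rw [← inner_sum, ← sum_inner, ← Finset.mul_sum, hy, mul_zero, inner_zero_left]

theorem abs_integral_likelihood_sq_sub_le {S : Finset ℂ} (hS : S.Nonempty) {y : ℂ → ℂ}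
    (hy : ∑ x ∈ S, y x = 0) {D : ℝ} (hD : ∀ x ∈ S, ‖y x‖ ≤ D) {a : ℂ} (ha : ‖a‖ ≤ 1) :
    |(∫ w, noiseDensity w * likelihood S (fun x => a * y x) w ^ 2) - 1
      - ‖a‖ ^ 4 * (((∑ x ∈ S, ‖y x‖ ^ 2) / S.card) ^ 2 + ‖(∑ x ∈ S, y x ^ 2) / S.card‖ ^ 2)|
      ≤ 8 * D ^ 6 * Real.exp (2 * D ^ 2) * ‖a‖ ^ 6 := by
  have hn : (0 : ℝ) < S.card := by exact_mod_cast hS.card_pos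
  obtain ⟨x₀, hx₀⟩ := hS
  have hD0 : 0 ≤ D := (norm_nonneg _).trans (hD x₀ hx₀)
  have ha0 := norm_nonneg a
  have key : ∀ x ∈ S, ∀ x' ∈ S, |Real.exp (2 * inner ℝ (a * y x) (a * y x')) - 1
      - 2 * inner ℝ (a * y x) (a * y x') - 2 * inner ℝ (a * y x) (a * y x') ^ 2|
      ≤ 8 * D ^ 6 * Real.exp (2 * D ^ 2) * ‖a‖ ^ 6 := by
    intro x hx x' hx'
    have hs : |inner ℝ (a * y x) (a * y x')| ≤ ‖a‖ ^ 2 * D ^ 2 := by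
      refine (abs_real_inner_le_norm _ _).trans ?_
      rw [norm_mul, norm_mul]
      calc ‖a‖ * ‖y x‖ * (‖a‖ * ‖y x'‖) ≤ ‖a‖ * D * (‖a‖ * D) := by
            gcongr
            · exact hD x hx
            · exact hD x' hx'
        _ = _ := by ring
    generalize (inner ℝ (a * y x) (a * y x') : ℝ) = s at hs
    have hs2 : |2 * s| ≤ 2 * (‖a‖ ^ 2 * D ^ 2) := by
      rw [abs_mul, abs_two]; linarith
    have hs3 : |2 * s| ≤ 2 * D ^ 2 := by
      refine hs2.trans ?_
      have : ‖a‖ ^ 2 * D ^ 2 ≤ 1 * D ^ 2 := by gcongr; exact pow_le_one₀ ha0 ha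
      linarith
    have h := abs_exp_sub_sum_range_le (2 * s) 3
    have e : Real.exp (2 * s) - 1 - 2 * s - 2 * s ^ 2
        = Real.exp (2 * s) - ∑ k ∈ Finset.range 3, (2 * s) ^ k / k.factorial := by
      simp only [Finset.sum_range_succ, Finset.sum_range_zero, Nat.factorial]
      push_cast
      ring
    rw [e]
    refine h.trans ?_
    calc |2 * s| ^ 3 * Real.exp |2 * s|
        ≤ (2 * (‖a‖ ^ 2 * D ^ 2)) ^ 3 * Real.exp (2 * D ^ 2) := by gcongr
      _ = _ := by ring
  have hsum : (∫ w, noiseDensity w * likelihood S (fun x => a * y x) w ^ 2) - 1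
      - ‖a‖ ^ 4 * (((∑ x ∈ S, ‖y x‖ ^ 2) / S.card) ^ 2 + ‖(∑ x ∈ S, y x ^ 2) / S.card‖ ^ 2)
      = (∑ x ∈ S, ∑ x' ∈ S, (Real.exp (2 * inner ℝ (a * y x) (a * y x')) - 1
      - 2 * inner ℝ (a * y x) (a * y x') - 2 * inner ℝ (a * y x) (a * y x') ^ 2))
        / (S.card : ℝ) ^ 2 := by
    rw [integral_noiseDensity_mul_likelihood_sq]
    simp_rw [Finset.sum_sub_distrib, ← Finset.mul_sum]
    rw [sum_sum_inner_mul_mul hy, sum_sum_inner_mul_mul_sq, norm_div, Complex.norm_natCast]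
    simp only [Finset.sum_const, nsmul_eq_mul, mul_one]
    field_simp
    ring
  rw [hsum, abs_div, abs_of_pos (pow_pos hn 2), div_le_iff₀ (pow_pos hn 2)]
  refine (Finset.abs_sum_le_sum_abs _ _).trans ?_
  refine (Finset.sum_le_card_nsmul _ _ _ fun x hx => (Finset.abs_sum_le_sum_abs _ _).trans
    (Finset.sum_le_card_nsmul _ _ _ (key x hx))).trans (le_of_eq ?_)
  simp only [nsmul_eq_mul]
  ring

/-- The relative entropy of the channel output with respect to the noise, up to fourth order in
the gain `a`, for a centred family of symbols. -/
theorem exists_abs_integral_likelihood_mul_log_sub_le {S : Finset ℂ} (hS : S.Nonempty)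
    {y : ℂ → ℂ} (hy : ∑ x ∈ S, y x = 0) :
    ∃ C, 0 ≤ C ∧ ∀ a : ℂ, ‖a‖ ≤ 1 →
      |(∫ w, noiseDensity w * (likelihood S (fun x => a * y x) w *
          Real.log (likelihood S (fun x => a * y x) w)))
        - ‖a‖ ^ 4 / 2 * (((∑ x ∈ S, ‖y x‖ ^ 2) / S.card) ^ 2
          + ‖(∑ x ∈ S, y x ^ 2) / S.card‖ ^ 2)| ≤ C * ‖a‖ ^ 6 := by
  set D := ∑ x ∈ S, ‖y x‖
  have hD : ∀ x ∈ S, ‖y x‖ ≤ D := fun x hx =>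
    Finset.single_le_sum (f := fun x => ‖y x‖) (fun _ _ => norm_nonneg _) hx
  have hD0 : 0 ≤ D := by positivity
  set J := ∫ w : ℂ, noiseDensity w * Real.exp (12 * D * ‖w‖)
  have hJ : 0 ≤ J := integral_nonneg fun w =>
    mul_nonneg (noiseDensity_nonneg w) (Real.exp_pos _).le
  -- The first term is half the chi-square error; in the second, `108 = 4 · 3³` comes from cubing
  -- the bound on `L - 1`, as do `6 * D ^ 2` and the `12 * D` in `J`.
  refine ⟨4 * D ^ 6 * Real.exp (2 * D ^ 2) + 108 * Real.exp (6 * D ^ 2) * J, by positivity,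
    fun a ha => ?_⟩
  have h2 := abs_integral_likelihood_sq_sub_le hS hy hD ha
  have hLi := integrable_noiseDensity_mul_likelihood_sq S fun x => a * y x
  have hLc := continuous_likelihood S fun x => a * y x
  have hL0 := likelihood_pos hS fun x => a * y x
  have hL1 := abs_likelihood_sub_one_le hS hy hD ha
  generalize likelihood S (fun x => a * y x) = L at *
  set r : ℂ → ℝ := fun w => L w * Real.log (L w) - (L w - 1) - (L w - 1) ^ 2 / 2 with hr
  have hrc : Continuous r := by
    have : Continuous fun w => Real.log (L w) := hLc.log fun w => (hL0 w).ne'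
    fun_prop
  have hrb : ∀ w, |r w| ≤ 108 * ‖a‖ ^ 6 * Real.exp (6 * D ^ 2) * Real.exp (12 * D * ‖w‖) := by
    intro w
    refine (abs_mul_log_sub_taylor_le (hL0 w)).trans ?_
    have h3 : |L w - 1| ^ 3 ≤ (‖a‖ ^ 2 * (3 * Real.exp (2 * (2 * D * ‖w‖ + D ^ 2)))) ^ 3 :=
      pow_le_pow_left₀ (abs_nonneg _) (hL1 w) 3
    have e : Real.exp (2 * (2 * D * ‖w‖ + D ^ 2)) ^ 3
        = Real.exp (6 * D ^ 2) * Real.exp (12 * D * ‖w‖) := by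
      rw [← Real.exp_nat_mul, ← Real.exp_add]
      congr 1
      push_cast
      ring
    rw [mul_pow, mul_pow, e] at h3
    linarith
  have hri : Integrable fun w => noiseDensity w * r w := integrable_noiseDensity_mul_of_le hrc hrb
  have hrI : |∫ w, noiseDensity w * r w| ≤ 108 * ‖a‖ ^ 6 * Real.exp (6 * D ^ 2) * J := by
    rw [← integral_const_mul, ← Real.norm_eq_abs]
    refine norm_integral_le_of_norm_le ((integrable_noiseDensity_mul_exp_norm _).const_mul _)
      (.of_forall fun w => ?_)
    rw [Real.norm_eq_abs, abs_mul, abs_of_nonneg (noiseDensity_nonneg w), mul_left_comm]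
    exact mul_le_mul_of_nonneg_left (hrb w) (noiseDensity_nonneg w)
  -- As `(L - 1) + (L - 1)²/2 = (L² - 1)/2`, only the second moment of `L` is needed.
  have hsplit : ∫ w, noiseDensity w * (L w * Real.log (L w))
      = ((∫ w, noiseDensity w * L w ^ 2) - 1) / 2 + ∫ w, noiseDensity w * r w := by
    have hi : Integrable fun w => (noiseDensity w * L w ^ 2 - noiseDensity w) / 2 :=
      (hLi.sub integrable_noiseDensity).div_const 2
    have e : ∀ w, noiseDensity w * (L w * Real.log (L w))
        = (noiseDensity w * L w ^ 2 - noiseDensity w) / 2 + noiseDensity w * r w := fun w => by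
      rw [hr]; ring
    simp_rw [e]
    rw [integral_add hi hri, integral_div, integral_sub hLi integrable_noiseDensity,
      integral_noiseDensity]
  rw [hsplit]
  rw [abs_le] at *
  constructor <;> linarith

/-- Taking the centre `mu1 S` turns the raw moments into the variance and the pseudo-variance. -/
theorem exists_abs_negInformation_expansion_le {S : Finset ℂ} (hS : S.Nonempty) :
    ∃ C, 0 ≤ C ∧ ∀ a : ℂ, ‖a‖ ≤ 1 →
      |negInformation S a - (‖a‖ ^ 4 / 2 * ((mu2 S - ‖mu1 S‖ ^ 2) ^ 2
        + ‖mu2' S - mu1 S ^ 2‖ ^ 2) - ‖a‖ ^ 2 * (mu2 S - ‖mu1 S‖ ^ 2))| ≤ C * ‖a‖ ^ 6 := by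
  have hn : (S.card : ℂ) ≠ 0 := by exact_mod_cast hS.card_pos.ne'
  have hn' : (S.card : ℝ) ≠ 0 := by exact_mod_cast hS.card_pos.ne'
  have hm : ∑ x ∈ S, x = S.card * mu1 S := by rw [mu1, mul_div_cancel₀ _ hn]
  have hy : ∑ x ∈ S, (x - mu1 S) = 0 := by
    rw [Finset.sum_sub_distrib, Finset.sum_const, nsmul_eq_mul, hm, sub_self]
  have h2 : (∑ x ∈ S, ‖x - mu1 S‖ ^ 2) / (S.card : ℝ) = mu2 S - ‖mu1 S‖ ^ 2 := by
    simp_rw [norm_sub_sq_real]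
    rw [Finset.sum_add_distrib, Finset.sum_sub_distrib, ← Finset.mul_sum, ← sum_inner, hm,
      ← nsmul_eq_mul (S.card) (mu1 S), ← Nat.cast_smul_eq_nsmul ℝ, real_inner_smul_left,
      real_inner_self_eq_norm_sq, mu2, Finset.sum_const, nsmul_eq_mul]
    field_simp
    ring
  have h2' : (∑ x ∈ S, (x - mu1 S) ^ 2) / (S.card : ℂ) = mu2' S - mu1 S ^ 2 := by
    simp_rw [sub_sq]
    rw [Finset.sum_add_distrib, Finset.sum_sub_distrib, ← Finset.sum_mul, ← Finset.mul_sum, hm,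
      mu2', Finset.sum_const, nsmul_eq_mul]
    field_simp
    ring
  obtain ⟨C, hC, h⟩ := exists_abs_integral_likelihood_mul_log_sub_le hS hy
  refine ⟨C, hC, fun a ha => ?_⟩
  have := h a ha
  rw [h2, h2'] at this
  rw [negInformation_eq hS a (mu1 S), h2]
  convert this using 2
  ring

theorem exists_abs_negInformation_le {S : Finset ℂ} (hS : S.Nonempty) :
    ∃ C, 0 ≤ C ∧ ∀ a : ℂ, |negInformation S a| ≤ C * (‖a‖ + ‖a‖ ^ 2) := by
  choose C hC h using exists_abs_meanLogRatio_le hS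
  have hn : (0 : ℝ) < S.card := by exact_mod_cast hS.card_pos
  refine ⟨(∑ x ∈ S, C x) / S.card, div_nonneg (Finset.sum_nonneg fun x _ => hC x) hn.le,
    fun a => ?_⟩
  rw [negInformation, abs_div, abs_of_pos hn, div_mul_eq_mul_div, Finset.sum_mul]
  exact div_le_div_of_nonneg_right ((Finset.abs_sum_le_sum_abs _ _).trans
    (Finset.sum_le_sum fun x _ => h x a)) hn.le

theorem stronglyMeasurable_negInformation {S : Finset ℂ} (hS : S.Nonempty) :
    StronglyMeasurable (negInformation S) := by
  refine Measurable.stronglyMeasurable ?_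
  have := fun x => (stronglyMeasurable_meanLogRatio hS x).measurable
  unfold negInformation
  fun_prop

-- Splitting the constellation by a label bit

section Labeling

variable {m : ℕ} {X : Finset ℂ} (γ : (Fin m → Bool) ≃ X) (i : Fin m)

theorem sum_sum_bitSubset {A : Type*} [AddCommMonoid A] (f : ℂ → A) :
    ∑ b : Bool, ∑ x ∈ bitSubset γ i b, f x = ∑ x ∈ X, f x := by
  simp_rw [bitSubset, Finset.sum_map]
  rw [Finset.sum_fiberwise Finset.univ (fun c : Fin m → Bool => c i), ← Finset.sum_coe_sort X,
    ← Equiv.sum_comp γ]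
  rfl

/-- Setting bit `i` to the other value is a bijection between the halves. -/
theorem card_bitSubset_true : (bitSubset γ i true).card = (bitSubset γ i false).card := by
  rw [bitSubset, bitSubset, Finset.card_map, Finset.card_map]
  refine Finset.card_nbij' (fun c => Function.update c i false)
    (fun c => Function.update c i true) ?_ ?_ ?_ ?_ <;> intro c hc <;> simp_all

theorem card_eq_two_mul_card_bitSubset (b : Bool) : X.card = 2 * (bitSubset γ i b).card := by
  have h := sum_sum_bitSubset γ i fun _ => 1
  simp only [Finset.sum_const, smul_eq_mul, mul_one, Fintype.sum_bool] at h
  have := card_bitSubset_true γ i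
  cases b <;> omega

theorem bitSubset_nonempty (b : Bool) : (bitSubset γ i b).Nonempty := by
  rw [bitSubset, Finset.map_nonempty]
  exact ⟨fun _ => b, by simp⟩

theorem half_sum_average_bitSubset (f : ℂ → ℝ) :
    1 / 2 * ∑ b : Bool, (∑ x ∈ bitSubset γ i b, f x) / ((bitSubset γ i b).card : ℝ)
      = (∑ x ∈ X, f x) / (X.card : ℝ) := by
  rw [← sum_sum_bitSubset γ i f, Finset.mul_sum, Finset.sum_div]
  refine Finset.sum_congr rfl fun b _ => ?_
  rw [card_eq_two_mul_card_bitSubset γ i b]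
  push_cast
  rw [div_mul_div_comm, one_mul]

/-- The mutual information between the `i`-th label bit and the output of the channel with
gain `a`. -/
def bitKernel (a : ℂ) : ℝ :=
  1 / 2 * ∑ b : Bool, negInformation (bitSubset γ i b) a - negInformation X a

/-- As `X` has twice as many points as each half, the `1 / 2` turns the ratio of sums into a ratio
of averages; the factor `exp (‖z‖ ^ 2)` cancels. -/
theorem log_likelihood_ratio_eq (hX : X.Nonempty) (b : Bool) (a x z : ℂ) :
    Real.log ((∑ x' ∈ bitSubset γ i b, Real.exp (-‖a * (x - x') + z‖ ^ 2)) /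
      ((1 / 2) * ∑ x' ∈ X, Real.exp (-‖a * (x - x') + z‖ ^ 2)))
      = logRatio (bitSubset γ i b) a x z - logRatio X a x z := by
  have hb := bitSubset_nonempty γ i b
  have hn : ((bitSubset γ i b).card : ℝ) ≠ 0 := by exact_mod_cast hb.card_pos.ne'
  rw [logRatio, logRatio, ← Real.log_div (sum_exp_div_card_pos hb _).ne'
    (sum_exp_div_card_pos hX _).ne', card_eq_two_mul_card_bitSubset γ i b]
  simp_rw [sub_eq_add_neg (‖z‖ ^ 2), Real.exp_add, ← Finset.mul_sum]
  have h1 : (∑ x' ∈ X, Real.exp (-‖a * (x - x') + z‖ ^ 2)) ≠ 0 :=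
    (Finset.sum_pos (fun _ _ => Real.exp_pos _) hX).ne'
  have h2 := (Real.exp_pos (‖z‖ ^ 2)).ne'
  congr 1
  push_cast
  field_simp

theorem integral_log_likelihood_ratio_eq (hX : X.Nonempty) (b : Bool) (a x : ℂ) :
    ∫ z : ℂ, noiseDensity z *
      Real.log ((∑ x' ∈ bitSubset γ i b, Real.exp (-‖a * (x - x') + z‖ ^ 2)) /
        ((1 / 2) * ∑ x' ∈ X, Real.exp (-‖a * (x - x') + z‖ ^ 2)))
      = meanLogRatio (bitSubset γ i b) a x - meanLogRatio X a x := by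
  simp_rw [log_likelihood_ratio_eq γ i hX, mul_sub (noiseDensity _)]
  exact integral_sub (integrable_noiseDensity_mul_logRatio (bitSubset_nonempty γ i b) a x)
    (integrable_noiseDensity_mul_logRatio hX a x)

theorem bitKernel_eq (a : ℂ) :
    bitKernel γ i a = (1 / 2) * ∑ b : Bool, (1 / ((bitSubset γ i b).card : ℝ)) *
      ∑ x ∈ bitSubset γ i b, (meanLogRatio (bitSubset γ i b) a x - meanLogRatio X a x) := by
  rw [bitKernel, negInformation, ← half_sum_average_bitSubset γ i, ← mul_sub,
    ← Finset.sum_sub_distrib]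
  congr 1
  refine Finset.sum_congr rfl fun b _ => ?_
  rw [negInformation, Finset.sum_sub_distrib]
  ring

end Labeling

-- Averaging over the fading

section Fading

variable {ν : Measure ℂ} [IsProbabilityMeasure ν]

theorem integrable_norm_sq_of_norm_pow_four (hν : Integrable (fun h : ℂ => ‖h‖ ^ 4) ν) :
    Integrable (fun h : ℂ => ‖h‖ ^ 2) ν := by
  refine (hν.add (integrable_const 1)).mono'
    (by fun_prop : Continuous fun h : ℂ => ‖h‖ ^ 2).aestronglyMeasurable (.of_forall fun h => ?_)
  rw [Real.norm_of_nonneg (by positivity)]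
  simp only [Pi.add_apply]
  nlinarith [sq_nonneg (‖h‖ ^ 2 - 1), sq_nonneg (‖h‖ ^ 2)]

theorem integrable_comp_mul_of_abs_le (hν : Integrable (fun h : ℂ => ‖h‖ ^ 4) ν) {f : ℂ → ℝ}
    (hf : StronglyMeasurable f) {C : ℝ} (hC : 0 ≤ C)
    (hfC : ∀ a, |f a| ≤ C * (‖a‖ + ‖a‖ ^ 2)) (s : ℂ) : Integrable (fun h => f (h * s)) ν := by
  refine (((integrable_norm_sq_of_norm_pow_four hν).const_mul (‖s‖ ^ 2)).add
    (integrable_const 1) |>.const_mul (2 * C)).mono'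
    (hf.comp_measurable (by fun_prop)).aestronglyMeasurable (.of_forall fun h => ?_)
  refine (hfC _).trans ?_
  rw [norm_mul, mul_pow]
  simp only [Pi.add_apply]
  nlinarith [mul_nonneg hC (sq_nonneg (‖h‖ * ‖s‖ - 1)), mul_nonneg hC (sq_nonneg (‖h‖ * ‖s‖))]

/-- Averaging a fourth-order expansion in the gain over a fading coefficient with finite fourth
moment. -/
theorem hasLowSNRCoefficients_integral (hν : Integrable (fun h : ℂ => ‖h‖ ^ 4) ν) {f : ℂ → ℝ}
    (hf : StronglyMeasurable f) {B C k₁ k₂ : ℝ} (hB : 0 ≤ B) (hC : 0 ≤ C)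
    (hfB : ∀ a, |f a| ≤ B * (‖a‖ + ‖a‖ ^ 2))
    (hfC : ∀ a, ‖a‖ ≤ 1 → |f a - (k₁ * ‖a‖ ^ 2 + k₂ * ‖a‖ ^ 4)| ≤ C * ‖a‖ ^ 6) :
    HasLowSNRCoefficients (fun snr => ∫ h, f (h * (Real.sqrt snr : ℂ)) ∂ν)
      ((∫ h, ‖h‖ ^ 2 ∂ν) * k₁) ((∫ h, (‖h‖ ^ 2) ^ 2 ∂ν) * k₂) := by
  set R : ℂ → ℝ := fun a => f a - (k₁ * ‖a‖ ^ 2 + k₂ * ‖a‖ ^ 4) with hR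
  -- `C` serves `‖a‖ ≤ 1`; the other terms serve `‖a‖ ≥ 1`, where every lower power is at most `‖a‖
  -- ^ 4`.
  set K := C + 2 * B + |k₁| + |k₂|
  have hRK : ∀ a, |R a| ≤ K * ‖a‖ ^ 4 := by
    intro a
    have h0 := norm_nonneg a
    have hk1 := abs_nonneg k₁
    have hk2 := abs_nonneg k₂
    rcases le_total ‖a‖ 1 with ha | ha
    · refine (hfC a ha).trans ?_
      have h1 : ‖a‖ ^ 6 ≤ ‖a‖ ^ 4 := pow_le_pow_of_le_one h0 ha (by norm_num)
      exact mul_le_mul (by linarith) h1 (by positivity) (by positivity)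
    · have h1 : ‖a‖ ≤ ‖a‖ ^ 4 := le_self_pow₀ ha (by norm_num)
      have h2 : ‖a‖ ^ 2 ≤ ‖a‖ ^ 4 := pow_le_pow_right₀ ha (by norm_num)
      calc |R a| ≤ |f a| + |k₁ * ‖a‖ ^ 2 + k₂ * ‖a‖ ^ 4| := abs_sub _ _
        _ ≤ B * (‖a‖ + ‖a‖ ^ 2) + (|k₁| * ‖a‖ ^ 2 + |k₂| * ‖a‖ ^ 4) := by
          refine add_le_add (hfB a) ((abs_add_le _ _).trans (le_of_eq ?_))
          rw [abs_mul, abs_mul, abs_of_nonneg (pow_nonneg h0 2), abs_of_nonneg (pow_nonneg h0 4)]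
        _ ≤ B * (‖a‖ ^ 4 + ‖a‖ ^ 4) + (|k₁| * ‖a‖ ^ 4 + |k₂| * ‖a‖ ^ 4) := by gcongr
        _ ≤ K * ‖a‖ ^ 4 := by
          have : 0 ≤ C * ‖a‖ ^ 4 := by positivity
          simp only [K]
          linarith
  have hν2 := integrable_norm_sq_of_norm_pow_four hν
  have hRm : StronglyMeasurable R :=
    hf.sub (by fun_prop : Continuous fun a : ℂ => k₁ * ‖a‖ ^ 2 + k₂ * ‖a‖ ^ 4).stronglyMeasurable
  have hnorm : ∀ {snr : ℝ}, 0 < snr → ∀ h : ℂ, ‖h * (Real.sqrt snr : ℂ)‖ ^ 2 = ‖h‖ ^ 2 * snr := by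
    intro snr hs h
    rw [norm_mul, mul_pow, Complex.norm_real, Real.norm_eq_abs, sq_abs, Real.sq_sqrt hs.le]
  have hnorm4 : ∀ {snr : ℝ}, 0 < snr → ∀ h : ℂ,
      ‖h * (Real.sqrt snr : ℂ)‖ ^ 4 = ‖h‖ ^ 4 * snr ^ 2 := by
    intro snr hs h
    rw [show ‖h * (Real.sqrt snr : ℂ)‖ ^ 4 = (‖h * (Real.sqrt snr : ℂ)‖ ^ 2) ^ 2 by ring,
      hnorm hs]
    ring
  have hpos : ∀ᶠ snr : ℝ in 𝓝[>] 0, 0 < snr := self_mem_nhdsWithin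
  rw [HasLowSNRCoefficients, isLittleO_iff_tendsto' (hpos.mono fun s hs h0 =>
    absurd h0 (pow_pos hs 2).ne')]
  have hlim : Tendsto (fun snr : ℝ => ∫ h, R (h * (Real.sqrt snr : ℂ)) / snr ^ 2 ∂ν) (𝓝[>] 0)
      (𝓝 (∫ _, (0 : ℝ) ∂ν)) := by
    refine tendsto_integral_filter_of_dominated_convergence (fun h => K * ‖h‖ ^ 4)
      (.of_forall fun snr => ?_) (hpos.mono fun snr hs => .of_forall fun h => ?_)
      (hν.const_mul K) (.of_forall fun h => ?_)
    · have h : StronglyMeasurable fun h : ℂ => R (h * (Real.sqrt snr : ℂ)) :=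
        hRm.comp_measurable (by fun_prop)
      exact (h.measurable.div_const _).aestronglyMeasurable
    · rw [Real.norm_eq_abs, abs_div, abs_of_pos (pow_pos hs 2), div_le_iff₀ (pow_pos hs 2),
        mul_assoc, ← hnorm4 hs]
      exact hRK _
    -- For fixed `h` the gain eventually has norm below `1`, so the sixth-order bound applies and
    -- leaves a factor `snr` after division by `snr ^ 2`.
    · have hz : Tendsto (fun snr : ℝ => C * ‖h‖ ^ 6 * snr) (𝓝[>] 0) (𝓝 0) := by
        have : Continuous fun snr : ℝ => C * ‖h‖ ^ 6 * snr := by fun_prop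
        simpa using (this.tendsto 0).mono_left nhdsWithin_le_nhds
      have hsmall : ∀ᶠ snr : ℝ in 𝓝[>] 0, ‖h‖ ^ 2 * snr < 1 := by
        have : Continuous fun snr : ℝ => ‖h‖ ^ 2 * snr := by fun_prop
        exact ((this.tendsto 0).mono_left nhdsWithin_le_nhds).eventually_lt_const (by simp)
      refine squeeze_zero_norm' ?_ hz
      filter_upwards [hpos, hsmall] with snr hs h1
      rw [← hnorm hs, sq_lt_one_iff₀ (norm_nonneg _)] at h1
      rw [Real.norm_eq_abs, abs_div, abs_of_pos (pow_pos hs 2), div_le_iff₀ (pow_pos hs 2)]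
      refine (hfC _ h1.le).trans (le_of_eq ?_)
      rw [show ‖h * (Real.sqrt snr : ℂ)‖ ^ 6 = (‖h * (Real.sqrt snr : ℂ)‖ ^ 2) ^ 3 by ring,
        hnorm hs]
      ring
  rw [integral_zero] at hlim
  refine hlim.congr' (hpos.mono fun snr hs => ?_)
  rw [integral_div]
  congr 1
  simp only [hR]
  have hi4 : Integrable (fun h : ℂ => (‖h‖ ^ 2) ^ 2) ν := hν.congr (.of_forall fun h => by ring)
  have e : ∀ h : ℂ, k₁ * ‖h * (Real.sqrt snr : ℂ)‖ ^ 2 + k₂ * ‖h * (Real.sqrt snr : ℂ)‖ ^ 4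
      = k₁ * snr * ‖h‖ ^ 2 + k₂ * snr ^ 2 * (‖h‖ ^ 2) ^ 2 := fun h => by
    rw [hnorm hs, hnorm4 hs]; ring
  have hi : Integrable (fun h : ℂ => k₁ * snr * ‖h‖ ^ 2 + k₂ * snr ^ 2 * (‖h‖ ^ 2) ^ 2) ν :=
    (hν2.const_mul _).add (hi4.const_mul _)
  simp_rw [e]
  rw [integral_sub (integrable_comp_mul_of_abs_le hν hf hB hfB _)
    hi, integral_add (hν2.const_mul _) (hi4.const_mul _),
    integral_const_mul, integral_const_mul]
  ring

variable {m : ℕ} {X : Finset ℂ} (γ : (Fin m → Bool) ≃ X) (i : Fin m)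

theorem bitInformation_eq_integral (hX : X.Nonempty)
    (hν : Integrable (fun h : ℂ => ‖h‖ ^ 4) ν) (snr : ℝ) :
    bitInformation ν γ snr i = ∫ h, bitKernel γ i (h * (Real.sqrt snr : ℂ)) ∂ν := by
  have hint : ∀ {S : Finset ℂ}, S.Nonempty → ∀ x,
      Integrable (fun h : ℂ => meanLogRatio S (h * (Real.sqrt snr : ℂ)) x) ν := by
    intro S hS x
    obtain ⟨C, hC, h⟩ := exists_abs_meanLogRatio_le hS x
    exact integrable_comp_mul_of_abs_le hν (stronglyMeasurable_meanLogRatio hS x) hC h _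
  have hsub : ∀ b, ∀ x, Integrable (fun h : ℂ =>
      meanLogRatio (bitSubset γ i b) (h * (Real.sqrt snr : ℂ)) x
        - meanLogRatio X (h * (Real.sqrt snr : ℂ)) x) ν := fun b x =>
    (hint (bitSubset_nonempty γ i b) x).sub (hint hX x)
  rw [bitInformation]
  simp_rw [integral_log_likelihood_ratio_eq γ i hX, bitKernel_eq]
  rw [integral_const_mul, integral_finsetSum _ fun b _ =>
    (integrable_finsetSum _ fun x _ => hsub b x).const_mul _]
  congr 1
  refine Finset.sum_congr rfl fun b _ => ?_
  rw [integral_const_mul, integral_finsetSum _ fun x _ => hsub b x]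

theorem hasLowSNRCoefficients_bitInformation (hX : X.Nonempty) (hmean : mu1 X = 0)
    (henergy : mu2 X = 1) (hν : Integrable (fun h : ℂ => ‖h‖ ^ 4) ν) :
    HasLowSNRCoefficients (fun snr => bitInformation ν γ snr i)
      ((∫ h, ‖h‖ ^ 2 ∂ν) * ((1 / 2) * ∑ b : Bool, ‖mu1 (bitSubset γ i b)‖ ^ 2))
      ((∫ h, (‖h‖ ^ 2) ^ 2 ∂ν) * ((1 / 4) * ∑ b : Bool,
        ((mu2 (bitSubset γ i b) - ‖mu1 (bitSubset γ i b)‖ ^ 2) ^ 2 - (1 + ‖mu2' X‖ ^ 2)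
          + ‖mu2' (bitSubset γ i b) - mu1 (bitSubset γ i b) ^ 2‖ ^ 2))) := by
  have hne := bitSubset_nonempty γ i
  simp_rw [bitInformation_eq_integral γ i hX hν]
  obtain ⟨B, hB, hBX⟩ := exists_abs_negInformation_le hX
  obtain ⟨C, hC, hCX⟩ := exists_abs_negInformation_expansion_le hX
  choose B' hB' hBb using fun b => exists_abs_negInformation_le (hne b)
  choose C' hC' hCb using fun b => exists_abs_negInformation_expansion_le (hne b)
  have hm : StronglyMeasurable (bitKernel γ i) := by
    refine Measurable.stronglyMeasurable ?_
    have h1 := (stronglyMeasurable_negInformation hX).measurable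
    have h2 := fun b => (stronglyMeasurable_negInformation (hne b)).measurable
    exact ((Finset.measurable_fun_sum _ fun b _ => h2 b).const_mul _).sub h1
  refine hasLowSNRCoefficients_integral hν hm (B := B + B' true + B' false)
    (C := C + C' true + C' false) (add_nonneg (add_nonneg hB (hB' _)) (hB' _))
    (add_nonneg (add_nonneg hC (hC' _)) (hC' _)) (fun a => ?_) fun a ha => ?_
  · have h1 := hBX a
    have h2 := hBb true a
    have h3 := hBb false a
    rw [bitKernel, Fintype.sum_bool]
    have h4 := (abs_nonneg _).trans h2
    have h5 := (abs_nonneg _).trans h3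
    rw [add_mul, add_mul]
    rw [abs_le] at *
    constructor <;> linarith
  · have h1 := hCX a ha
    have h2 := hCb true a ha
    have h3 := hCb false a ha
    have h4 := (abs_nonneg _).trans h2
    have h5 := (abs_nonneg _).trans h3
    have h6 := half_sum_average_bitSubset γ i fun x => ‖x‖ ^ 2
    change 1 / 2 * ∑ b : Bool, mu2 (bitSubset γ i b) = mu2 X at h6
    rw [hmean, henergy] at h1
    rw [henergy, Fintype.sum_bool] at h6
    simp only [norm_zero, ne_eq, OfNat.ofNat_ne_zero, not_false_eq_true, zero_pow, sub_zero,
      one_pow, mul_one] at h1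
    simp_rw [bitKernel, Fintype.sum_bool]
    -- The halves have average energy `1`, the energy of `X`: the energies cancel at first order and
    -- leave only the `‖mu1‖ ^ 2` terms.
    have h7 : mu2 (bitSubset γ i true) = 2 - mu2 (bitSubset γ i false) := by linarith
    rw [h7] at h2 ⊢
    rw [add_mul, add_mul]
    rw [abs_le] at *
    constructor <;> linarith

theorem hasLowSNRCoefficients_capacity (hX : X.Nonempty) (hmean : mu1 X = 0)
    (henergy : mu2 X = 1) (hν : Integrable (fun h : ℂ => ‖h‖ ^ 4) ν) :
    HasLowSNRCoefficients (capacity ν γ)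
      ((∫ h, ‖h‖ ^ 2 ∂ν) * ∑ i : Fin m, (1 / 2) * ∑ b : Bool, ‖mu1 (bitSubset γ i b)‖ ^ 2)
      ((∫ h, (‖h‖ ^ 2) ^ 2 ∂ν) * ∑ i : Fin m, (1 / 4) * ∑ b : Bool,
        ((mu2 (bitSubset γ i b) - ‖mu1 (bitSubset γ i b)‖ ^ 2) ^ 2 - (1 + ‖mu2' X‖ ^ 2)
          + ‖mu2' (bitSubset γ i b) - mu1 (bitSubset γ i b) ^ 2‖ ^ 2)) := by
  have h := IsLittleO.sum (s := Finset.univ) fun i _ =>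
    hasLowSNRCoefficients_bitInformation γ i hX hmean henergy hν
  refine h.congr_left fun snr => ?_
  simp only [Finset.sum_apply, capacity, Finset.sum_sub_distrib, Finset.sum_add_distrib,
    ← Finset.sum_mul, ← Finset.mul_sum]

end Fading

end BICM

end

theorem theorem2 {m : ℕ} (X : Finset ℂ) (γ : (Fin m → Bool) ≃ X)
    (hmean : BICM.mu1 X = 0) (henergy : BICM.mu2 X = 1) (c₁ c₂ : ℝ)
    (hc₁ : c₁ = ∑ i : Fin m, (1 / 2) * ∑ b : Bool, ‖BICM.mu1 (BICM.bitSubset γ i b)‖ ^ 2)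
    (hc₂ : c₂ = ∑ i : Fin m, (1 / 4) * ∑ b : Bool,
      ((BICM.mu2 (BICM.bitSubset γ i b) - ‖BICM.mu1 (BICM.bitSubset γ i b)‖ ^ 2) ^ 2
        - (1 + ‖BICM.mu2' X‖ ^ 2)
        + ‖BICM.mu2' (BICM.bitSubset γ i b) - BICM.mu1 (BICM.bitSubset γ i b) ^ 2‖ ^ 2)) :
    BICM.HasLowSNRCoefficients (BICM.awgnCapacity γ) c₁ c₂ ∧
    ∀ ν : Measure ℂ, IsProbabilityMeasure ν → Integrable (fun h : ℂ => ‖h‖ ^ 4) ν →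
      BICM.HasLowSNRCoefficients (BICM.capacity ν γ)
        ((∫ h : ℂ, ‖h‖ ^ 2 ∂ν) * c₁) ((∫ h : ℂ, (‖h‖ ^ 2) ^ 2 ∂ν) * c₂) := by
  subst hc₁ hc₂
  have hX : X.Nonempty := ⟨γ fun _ => true, (γ fun _ => true).2⟩
  refine ⟨?_, fun ν _ hν => BICM.hasLowSNRCoefficients_capacity γ hX hmean henergy hν⟩
  have h := BICM.hasLowSNRCoefficients_capacity (ν := Measure.dirac 1) γ hX hmean henergy
    (integrable_dirac (by simp))
  simp only [integral_dirac, norm_one, one_pow, one_mul] at h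
  exact h
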